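/- For a real number $x$ let $\|x\|$ denote the distance from $x$ to the nearest integer. A Pisot number is a real algebraic integer $\zeta>1$ all of whose conjugates other than $\zeta$ itself have absolute value strictly less than $1$; a Pisot unit is a Pisot number that is a unit in the ring of algebraic integers. For a Pisot number $\zeta$ put $$\mathscr{M}_\zeta=\{\alpha\in\mathbb{R} : \lim_{n\to\infty}\|\alpha\zeta^n\|=0\},$$ which is a $\mathbb{Z}$-module and also a module over the ring $\mathbb{Z}[\zeta]\subset\mathbb{R}$ generated by $\zeta$. Let $\zeta$ be a Pisot number. Then: 1. $\mathscr{M}_\zeta$ is finitely generated as a $\mathbb{Z}$-module if and only if $\zeta$ is a Pisot unit, and $\mathscr{M}_\zeta$ is finitely generated as a $\mathbb{Z}[\zeta]$-module if and only if $\zeta$ is a Pisot unit. 2. If $\mathscr{M}_\zeta$ is free as a $\mathbb{Z}$-module, or free as a $\mathbb{Z}[\zeta]$-module, then $\zeta$ is a Pisot unit. 3. Conversely, if $\zeta$ is a Pisot unit of degree $k=[\mathbb{Q}(\zeta):\mathbb{Q}]$, then $\mathscr{M}_\zeta$ is free as a $\mathbb{Z}$-module, with $\mathscr{M}_\zeta\cong\mathbb{Z}^k$.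 If in addition $\mathbb{Z}[\zeta]$ is a principal ideal domain, then $\mathscr{M}_\zeta$ is free of rank one as a $\mathbb{Z}[\zeta]$-module, so that $\mathscr{M}_\zeta\cong\mathbb{Z}[\zeta]$ as $\mathbb{Z}[\zeta]$-modules. -/

import Mathlib

open Filter Topology Polynomial

/-- Distance of a real number to the nearest integer (`round x = ⌊x + 1/2⌋`). -/
noncomputable def distNearestInt (x : ℝ) : ℝ := |x - round x|

/-- A Pisot number: a real algebraic integer `ζ > 1` all of whose conjugates (complex roots of its
minimal polynomial over `ℚ`) other than `ζ` lie strictly inside the unit circle. -/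
def IsPisot (ζ : ℝ) : Prop :=
  IsIntegral ℤ ζ ∧ 1 < ζ ∧
    ∀ z : ℂ, aeval z (minpoly ℚ ζ) = 0 → z ≠ (ζ : ℂ) → ‖z‖ < 1

/-- A Pisot unit: a Pisot number that is a unit in the ring of algebraic integers. -/
def IsPisotUnit (ζ : ℝ) : Prop :=
  IsPisot ζ ∧ ∃ u : (integralClosure ℤ ℝ)ˣ, ((u : integralClosure ℤ ℝ) : ℝ) = ζ

/-- The set of real `α` such that the distance of `α ζ ^ n` to the nearest integer tends to `0`. -/
def pisotSet (ζ : ℝ) : Set ℝ :=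
  {α : ℝ | Tendsto (fun n : ℕ => distNearestInt (α * ζ ^ n)) atTop (𝓝 0)}

theorem distNearestInt_nonneg (x : ℝ) : 0 ≤ distNearestInt x := abs_nonneg _

theorem distNearestInt_add_le (x y : ℝ) :
    distNearestInt (x + y) ≤ distNearestInt x + distNearestInt y := by
  unfold distNearestInt
  calc |x + y - round (x + y)| ≤ |x + y - ((round x + round y : ℤ) : ℝ)| := round_le _ _
    _ = |(x - round x) + (y - round y)| := by push_cast; ring_nf
    _ ≤ _ := abs_add_le _ _

theorem distNearestInt_intCast_mul_le (m : ℤ) (x : ℝ) :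
    distNearestInt (m * x) ≤ |(m : ℝ)| * distNearestInt x := by
  unfold distNearestInt
  calc |m * x - round (m * x)| ≤ |m * x - ((m * round x : ℤ) : ℝ)| := round_le _ _
    _ = |(m : ℝ) * (x - round x)| := by push_cast; ring_nf
    _ = _ := abs_mul _ _

theorem zero_mem_pisotSet (ζ : ℝ) : (0 : ℝ) ∈ pisotSet ζ := by
  simp [pisotSet, distNearestInt]

theorem add_mem_pisotSet {ζ a b : ℝ} (ha : a ∈ pisotSet ζ) (hb : b ∈ pisotSet ζ) :
    a + b ∈ pisotSet ζ := by
  have h := Tendsto.add ha hb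
  rw [add_zero] at h
  refine squeeze_zero (fun n => distNearestInt_nonneg _) (fun n => ?_) h
  rw [add_mul]
  exact distNearestInt_add_le _ _

theorem intCast_mul_mem_pisotSet {ζ a : ℝ} (m : ℤ) (ha : a ∈ pisotSet ζ) :
    (m : ℝ) * a ∈ pisotSet ζ := by
  have h := Tendsto.const_mul |(m : ℝ)| ha
  rw [mul_zero] at h
  refine squeeze_zero (fun n => distNearestInt_nonneg _) (fun n => ?_) h
  rw [mul_assoc]
  exact distNearestInt_intCast_mul_le _ _

theorem self_mul_mem_pisotSet {ζ a : ℝ} (ha : a ∈ pisotSet ζ) : ζ * a ∈ pisotSet ζ := by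
  refine ((tendsto_add_atTop_iff_nat 1).2 ha).congr (fun n => ?_)
  rw [pow_succ]
  ring_nf

theorem adjoin_mul_mem_pisotSet {ζ c : ℝ} (hc : c ∈ Algebra.adjoin ℤ {ζ}) :
    ∀ a ∈ pisotSet ζ, c * a ∈ pisotSet ζ := by
  induction hc using Algebra.adjoin_induction with
  | mem x hx =>
    intro a ha
    rw [Set.mem_singleton_iff.1 hx]
    exact self_mul_mem_pisotSet ha
  | algebraMap m => exact fun a ha => intCast_mul_mem_pisotSet m ha
  | add x y _ _ hx hy =>
    intro a ha
    rw [add_mul]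
    exact add_mem_pisotSet (hx a ha) (hy a ha)
  | mul x y _ _ hx hy =>
    intro a ha
    rw [mul_assoc]
    exact hx _ (hy a ha)

/-- `pisotSet ζ` as a `ℤ`-module. -/
def pisotIntModule (ζ : ℝ) : Submodule ℤ ℝ where
  carrier := pisotSet ζ
  zero_mem' := zero_mem_pisotSet ζ
  add_mem' := add_mem_pisotSet
  smul_mem' m a ha := by
    rw [zsmul_eq_mul]
    exact intCast_mul_mem_pisotSet m ha

/-- `pisotSet ζ` as a module over `ℤ[ζ]`, the subring of `ℝ` generated by `ζ`. -/
def pisotAdjoinModule (ζ : ℝ) : Submodule (Algebra.adjoin ℤ {ζ}) ℝ where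
  carrier := pisotSet ζ
  zero_mem' := zero_mem_pisotSet ζ
  add_mem' := add_mem_pisotSet
  smul_mem' c a ha := adjoin_mul_mem_pisotSet c.2 a ha

/-! Let `k` be the degree of `ζ` and `L ≅ ℤ^k` the integer sequences obeying the recurrence of its
minimal polynomial. As the other conjugates lie in the open unit disc, each such sequence is `α ζ^n
+ o(1)`, and taking `α` embeds `L` in the module `M` of the theorem (`leadCoeff_injective`).
Conversely, for `α` in `M` the nearest integers to `α ζ^n` satisfy the recurrence up to integer
errors tending to `0`, hence exactly from some point on. So `M` is the union of the `ζ^(-n) L`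
(`exists_leadCoeff_eq_mul_pow`), which is `L` itself once `ζ⁻¹ ∈ ℤ[ζ]`.

In the other direction, `M` is nonzero, torsion-free and equal to `ζ M`. If `M` is finite over
`ℤ[ζ]`, Nakayama makes `ζ` a unit; if it is free, a coordinate of a basis vector does. Freeness over
`ℤ` reduces to finiteness because `M` has rank at most `k`. -/

/-! ### Polynomials in the shift operator -/

/-- The shift operator on sequences, sending `s` to `n ↦ s (n + 1)`. -/
def seqShift (R : Type*) [CommRing R] : (ℕ → R) →ₗ[R] (ℕ → R) :=
  LinearMap.funLeft R R (· + 1)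

theorem seqShift_apply {R : Type*} [CommRing R] (s : ℕ → R) (n : ℕ) :
    seqShift R s n = s (n + 1) := rfl

theorem seqShift_pow_apply {R : Type*} [CommRing R] (i : ℕ) (s : ℕ → R) (n : ℕ) :
    (seqShift R ^ i) s n = s (n + i) := by
  induction i generalizing n with
  | zero => simp
  | succ i ih =>
    rw [pow_succ', Module.End.mul_apply, seqShift_apply, ih]
    congr 1
    omega

theorem aeval_seqShift_apply {R : Type*} [CommRing R] (P : R[X]) (s : ℕ → R) (n : ℕ) :
    aeval (seqShift R) P s n =
      ∑ i ∈ Finset.range (P.natDegree + 1), P.coeff i * s (n + i) := by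
  rw [aeval_eq_sum_range]
  simp [seqShift_pow_apply]

theorem aeval_seqShift_pow {R : Type*} [CommRing R] (P : R[X]) (a c : R) :
    aeval (seqShift R) P (fun n => c * a ^ n) = fun n => P.eval a * (c * a ^ n) := by
  funext n
  rw [aeval_seqShift_apply, eval_eq_sum_range, Finset.sum_mul]
  refine Finset.sum_congr rfl fun i _ => ?_
  rw [pow_add]
  ring

theorem aeval_seqShift_map {R A : Type*} [CommRing R] [CommRing A] (f : R →+* A)
    (hf : Function.Injective f) (P : R[X]) (s : ℕ → R) (n : ℕ) :
    aeval (seqShift A) (P.map f) (fun n => f (s n)) n = f (aeval (seqShift R) P s n) := by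
  simp [aeval_seqShift_apply, natDegree_map_eq_of_injective hf]

/-! ### Geometric decay -/

/-- A sequence whose perturbed ratio-`z` recursion decays geometrically, with `‖z‖ < 1`, itself
decays geometrically. -/
theorem geometric_bound_of_sub_mul {z : ℂ} (hz : ‖z‖ < 1) {t : ℕ → ℂ}
    (h : ∃ C r : ℝ, 0 ≤ r ∧ r < 1 ∧ ∀ n, ‖t (n + 1) - z * t n‖ ≤ C * r ^ n) :
    ∃ C r : ℝ, 0 ≤ r ∧ r < 1 ∧ ∀ n, ‖t n‖ ≤ C * r ^ n := by
  obtain ⟨C, r, hr0, hr1, h⟩ := h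
  -- The midpoint of `‖z‖` and `1` keeps `q` strictly above `‖z‖`, so `C ≤ D (q - ‖z‖)` can be
  -- arranged and the induction closes.
  set q := max r ((1 + ‖z‖) / 2) with hq
  have hrq : r ≤ q := le_max_left _ _
  have hzq : ‖z‖ < q := lt_of_lt_of_le (by linarith) (le_max_right _ _)
  have hC : 0 ≤ C := by simpa using (norm_nonneg _).trans (h 0)
  set D := max ‖t 0‖ (C / (q - ‖z‖)) with hD
  have hCD : C ≤ D * (q - ‖z‖) := (div_le_iff₀ (by linarith)).1 (le_max_right _ _)
  refine ⟨D, q, hr0.trans hrq, max_lt hr1 (by linarith), fun n => ?_⟩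
  induction n with
  | zero => simp [hD]
  | succ n ih =>
    have hqn : 0 ≤ q ^ n := pow_nonneg (hr0.trans hrq) n
    calc ‖t (n + 1)‖ = ‖(t (n + 1) - z * t n) + z * t n‖ := by ring_nf
      _ ≤ ‖t (n + 1) - z * t n‖ + ‖z‖ * ‖t n‖ := by
        rw [← norm_mul]
        exact norm_add_le _ _
      _ ≤ C * q ^ n + ‖z‖ * (D * q ^ n) := by
        gcongr
        exact (h n).trans (by gcongr)
      _ ≤ D * (q - ‖z‖) * q ^ n + ‖z‖ * (D * q ^ n) := by gcongr
      _ = D * q ^ (n + 1) := by ring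

/-- Linear factors are peeled off one at a time, each leaving a ratio-`a` recursion with a
geometrically small perturbation. -/
theorem geometric_bound_of_aeval_prod_eq_zero (m : Multiset ℂ) (hm : ∀ a ∈ m, ‖a‖ < 1)
    (t : ℕ → ℂ) (ht : aeval (seqShift ℂ) (m.map fun a => X - C a).prod t = 0) :
    ∃ C r : ℝ, 0 ≤ r ∧ r < 1 ∧ ∀ n, ‖t n‖ ≤ C * r ^ n := by
  induction m using Multiset.induction_on generalizing t with
  | empty =>
    have : t = 0 := by simpa using ht
    exact ⟨0, 0, le_rfl, zero_lt_one, by simp [this]⟩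
  | cons a m ih =>
    rw [Multiset.map_cons, Multiset.prod_cons, mul_comm, map_mul, Module.End.mul_apply] at ht
    have := ih (fun b hb => hm b (Multiset.mem_cons_of_mem hb)) _ ht
    refine geometric_bound_of_sub_mul (hm a (Multiset.mem_cons_self a m)) ?_
    simpa [seqShift_apply] using this

theorem tendsto_zero_of_aeval_prod_eq_zero (m : Multiset ℂ) (hm : ∀ a ∈ m, ‖a‖ < 1)
    (t : ℕ → ℂ) (ht : aeval (seqShift ℂ) (m.map fun a => X - C a).prod t = 0) :
    Tendsto t atTop (𝓝 0) := by
  obtain ⟨C, r, hr0, hr1, h⟩ := geometric_bound_of_aeval_prod_eq_zero m hm t ht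
  refine squeeze_zero_norm h ?_
  simpa using (tendsto_pow_atTop_nhds_zero_of_lt_one hr0 hr1).const_mul C

/-! ### Factorization of the minimal polynomial -/

theorem IsPisot.map_minpoly_int {ζ : ℝ} (hζ : IsPisot ζ) :
    (minpoly ℤ ζ).map (algebraMap ℤ ℚ) = minpoly ℚ ζ :=
  (minpoly.isIntegrallyClosed_eq_field_fractions' ℚ hζ.1).symm

/-- Over `ℂ`, the minimal polynomial of a Pisot number is `X - ζ` times a product of linear factors
with roots in the open unit disc. -/
theorem IsPisot.exists_factorization {ζ : ℝ} (hζ : IsPisot ζ) :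
    ∃ m : Multiset ℂ, (∀ a ∈ m, ‖a‖ < 1) ∧
      (minpoly ℤ ζ).map (algebraMap ℤ ℂ) = (X - C (ζ : ℂ)) * (m.map fun a => X - C a).prod := by
  have hmap : (minpoly ℤ ζ).map (algebraMap ℤ ℂ) = (minpoly ℚ ζ).map (algebraMap ℚ ℂ) := by
    rw [← hζ.map_minpoly_int, Polynomial.map_map, ← IsScalarTower.algebraMap_eq]
  have hint : IsIntegral ℚ ζ := hζ.1.tower_top
  have hne : (minpoly ℚ ζ).map (algebraMap ℚ ℂ) ≠ 0 :=
    Polynomial.map_ne_zero (minpoly.ne_zero hint)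
  have hsep : ((minpoly ℚ ζ).map (algebraMap ℚ ℂ)).Separable :=
    (minpoly.irreducible hint).separable.map
  have hroot : aeval (ζ : ℂ) (minpoly ℚ ζ) = 0 := by
    have := aeval_algebraMap_apply ℂ ζ (minpoly ℚ ζ)
    simpa using this
  have hmem : (ζ : ℂ) ∈ ((minpoly ℚ ζ).map (algebraMap ℚ ℂ)).roots := by
    rw [mem_roots hne, IsRoot.def, eval_map_algebraMap, hroot]
  obtain ⟨m, hm⟩ := Multiset.exists_cons_of_mem hmem
  -- Separability ensures that `ζ` does not recur among the remaining roots.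
  have hnd := nodup_roots hsep
  rw [hm, Multiset.nodup_cons] at hnd
  refine ⟨m, fun a ha => hζ.2.2 a ?_ fun h => hnd.1 (h ▸ ha), ?_⟩
  · have : a ∈ ((minpoly ℚ ζ).map (algebraMap ℚ ℂ)).roots := hm ▸ Multiset.mem_cons_of_mem ha
    rwa [mem_roots hne, IsRoot.def, eval_map_algebraMap] at this
  · rw [hmap, (IsAlgClosed.splits ((minpoly ℚ ζ).map (algebraMap ℚ ℂ))).eq_prod_roots_of_monic
      ((minpoly.monic hint).map _), hm, Multiset.map_cons, Multiset.prod_cons]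

/-! ### Integer recurrent sequences -/

/-- The integer sequences satisfying the linear recurrence given by the minimal polynomial. -/
noncomputable def recSeq (ζ : ℝ) : Submodule ℤ (ℕ → ℤ) :=
  LinearMap.ker (aeval (seqShift ℤ) (minpoly ℤ ζ))

theorem mem_recSeq {ζ : ℝ} {s : ℕ → ℤ} :
    s ∈ recSeq ζ ↔ aeval (seqShift ℤ) (minpoly ℤ ζ) s = 0 := LinearMap.mem_ker

theorem seqShift_mem_recSeq {ζ : ℝ} {s : ℕ → ℤ} (hs : s ∈ recSeq ζ) :
    seqShift ℤ s ∈ recSeq ζ := by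
  rw [mem_recSeq] at hs ⊢
  have h : aeval (seqShift ℤ) (minpoly ℤ ζ) (seqShift ℤ s) =
      seqShift ℤ (aeval (seqShift ℤ) (minpoly ℤ ζ) s) := by
    have := congrArg (fun p => aeval (seqShift ℤ) p s) (mul_comm (minpoly ℤ ζ) X)
    simpa using this
  rw [h, hs, map_zero]

/-- With the minimal polynomial written `(X - ζ) Q`, applying `Q` to the shift turns `s` into a
geometric sequence `d 0 * ζ ^ n`. Subtracting `β ζ^n` with `β = d 0 / Q(ζ)` leaves a sequence killed
by `Q`, which decays. -/
theorem IsPisot.exists_tendsto {ζ : ℝ} (hζ : IsPisot ζ) {s : ℕ → ℤ} (hs : s ∈ recSeq ζ) :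
    ∃ α : ℝ, Tendsto (fun n => (s n : ℝ) - α * ζ ^ n) atTop (𝓝 0) := by
  obtain ⟨m, hm, hP⟩ := hζ.exists_factorization
  set Q : ℂ[X] := (m.map fun a => X - C a).prod with hQ
  set sc : ℕ → ℂ := fun n => algebraMap ℤ ℂ (s n) with hsc
  set d := aeval (seqShift ℂ) Q sc with hd
  have hdrec : ∀ n, d (n + 1) = ζ * d n := by
    intro n
    have h : aeval (seqShift ℂ) ((minpoly ℤ ζ).map (algebraMap ℤ ℂ)) sc n = 0 := by
      rw [aeval_seqShift_map _ (algebraMap ℤ ℂ).injective_int, mem_recSeq.1 hs]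
      simp
    rw [hP, map_mul, Module.End.mul_apply, ← hd] at h
    have h' : d (n + 1) - ζ * d n = 0 := by simpa [seqShift_apply] using h
    exact sub_eq_zero.1 h'
  have hdn : ∀ n, d n = d 0 * ζ ^ n := by
    intro n
    induction n with
    | zero => simp
    | succ n ih => rw [hdrec, ih]; ring
  have hQζ : Q.eval (ζ : ℂ) ≠ 0 := by
    rw [hQ, eval_multiset_prod, Multiset.map_map]
    refine Multiset.prod_ne_zero fun h => ?_
    obtain ⟨a, ha, h⟩ := Multiset.mem_map.1 h
    have h' : (ζ : ℂ) = a := by simpa [sub_eq_zero] using h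
    have := hm a ha
    rw [← h', Complex.norm_real, Real.norm_eq_abs, abs_of_pos (by linarith [hζ.2.1])] at this
    linarith [hζ.2.1]
  set β : ℂ := d 0 / Q.eval (ζ : ℂ) with hβ
  have ht : aeval (seqShift ℂ) Q (sc - fun n => β * (ζ : ℂ) ^ n) = 0 := by
    rw [map_sub, aeval_seqShift_pow, ← hd]
    funext n
    simp only [Pi.sub_apply, Pi.zero_apply]
    rw [hdn, hβ]
    field_simp
    ring
  have h0 := tendsto_zero_of_aeval_prod_eq_zero m hm _ ht
  -- Both `s n` and `ζ ^ n` are real, so real parts can be taken.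
  refine ⟨β.re, ?_⟩
  have h1 := (Complex.continuous_re.tendsto 0).comp h0
  rw [Complex.zero_re] at h1
  refine h1.congr fun n => ?_
  simp only [Function.comp_apply, Pi.sub_apply, hsc, ← Complex.ofReal_pow, Complex.sub_re,
    Complex.re_mul_ofReal]
  simp

theorem recSeq_eq_solSpace {ζ : ℝ} (hζ : IsPisot ζ) :
    recSeq ζ = (LinearRecurrence.mk (minpoly ℤ ζ).natDegree
      fun i : Fin _ => -(minpoly ℤ ζ).coeff i).solSpace := by
  ext s
  rw [← LinearRecurrence.is_sol_iff_mem_solSpace, mem_recSeq, funext_iff,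
    LinearRecurrence.IsSolution]
  refine forall_congr' fun n => ?_
  rw [aeval_seqShift_apply, Finset.sum_range_succ, (minpoly.monic hζ.1).coeff_natDegree, one_mul,
    Finset.sum_range, Pi.zero_apply]
  simp only [neg_mul, Finset.sum_neg_distrib]
  rw [add_comm, add_eq_zero_iff_eq_neg]

/-- A sequence in `recSeq ζ` is determined by its first `natDegree` terms. -/
noncomputable def recSeqEquiv {ζ : ℝ} (hζ : IsPisot ζ) :
    recSeq ζ ≃ₗ[ℤ] (Fin (minpoly ℚ ζ).natDegree → ℤ) :=
  (LinearEquiv.ofEq _ _ (recSeq_eq_solSpace hζ)).trans <|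
    (LinearRecurrence.toInit _).trans <| LinearEquiv.funCongrLeft ℤ ℤ <| finCongr <| by
      rw [← hζ.map_minpoly_int]
      exact natDegree_map_eq_of_injective (algebraMap ℤ ℚ).injective_int _

/-! ### Leading coefficients -/

theorem IsPisot.pos {ζ : ℝ} (hζ : IsPisot ζ) : 0 < ζ := zero_lt_one.trans hζ.2.1

/-- A nonzero multiple of `ζ ^ n` does not tend to zero. -/
theorem IsPisot.eq_zero_of_tendsto {ζ : ℝ} (hζ : IsPisot ζ) {α : ℝ}
    (h : Tendsto (fun n => α * ζ ^ n) atTop (𝓝 0)) : α = 0 := by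
  have hinv : Tendsto (fun n => (ζ⁻¹) ^ n) atTop (𝓝 0) :=
    tendsto_pow_atTop_nhds_zero_of_lt_one (inv_nonneg.2 hζ.pos.le) (inv_lt_one_of_one_lt₀ hζ.2.1)
  have h' := h.mul hinv
  rw [mul_zero] at h'
  refine tendsto_nhds_unique (tendsto_const_nhds.congr fun n => ?_) h'
  rw [inv_pow, mul_assoc, mul_inv_cancel₀ (pow_ne_zero n hζ.pos.ne'), mul_one]

theorem IsPisot.tendsto_unique {ζ : ℝ} (hζ : IsPisot ζ) {s : ℕ → ℝ} {α β : ℝ}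
    (hα : Tendsto (fun n => s n - α * ζ ^ n) atTop (𝓝 0))
    (hβ : Tendsto (fun n => s n - β * ζ ^ n) atTop (𝓝 0)) : α = β := by
  refine sub_eq_zero.1 (hζ.eq_zero_of_tendsto ?_)
  have := hβ.sub hα
  rw [sub_zero] at this
  exact this.congr fun n => by ring

theorem mem_pisotSet_of_tendsto {ζ α : ℝ} {s : ℕ → ℤ}
    (h : Tendsto (fun n => (s n : ℝ) - α * ζ ^ n) atTop (𝓝 0)) : α ∈ pisotSet ζ := by
  have h' := h.abs
  rw [abs_zero] at h'
  refine squeeze_zero (fun n => distNearestInt_nonneg _) (fun n => ?_) h'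
  rw [abs_sub_comm]
  exact round_le _ _

/-- The leading coefficient `α` of a recurrent sequence `s n = α ζ ^ n + o(1)`. -/
noncomputable def leadCoeff {ζ : ℝ} (hζ : IsPisot ζ) : recSeq ζ →ₗ[ℤ] pisotIntModule ζ where
  toFun s := ⟨(hζ.exists_tendsto s.2).choose,
    mem_pisotSet_of_tendsto (hζ.exists_tendsto s.2).choose_spec⟩
  map_add' s t := by
    refine Subtype.ext (hζ.tendsto_unique (hζ.exists_tendsto (s + t).2).choose_spec ?_)
    have := (hζ.exists_tendsto s.2).choose_spec.add (hζ.exists_tendsto t.2).choose_spec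
    rw [add_zero] at this
    refine this.congr fun n => ?_
    simp only [Submodule.coe_add, Pi.add_apply, Int.cast_add]
    ring
  map_smul' m s := by
    refine Subtype.ext (hζ.tendsto_unique (hζ.exists_tendsto (m • s).2).choose_spec ?_)
    have := (hζ.exists_tendsto s.2).choose_spec.const_mul (m : ℝ)
    rw [mul_zero] at this
    refine this.congr fun n => ?_
    simp only [Submodule.coe_smul, Pi.smul_apply, smul_eq_mul, Int.cast_mul, RingHom.id_apply,
      zsmul_eq_mul]
    ring

theorem leadCoeff_spec {ζ : ℝ} (hζ : IsPisot ζ) (s : recSeq ζ) :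
    Tendsto (fun n => ((s : ℕ → ℤ) n : ℝ) - leadCoeff hζ s * ζ ^ n) atTop (𝓝 0) :=
  (hζ.exists_tendsto s.2).choose_spec

theorem leadCoeff_eq_of_tendsto {ζ : ℝ} (hζ : IsPisot ζ) {s : recSeq ζ} {α : ℝ}
    (h : Tendsto (fun n => ((s : ℕ → ℤ) n : ℝ) - α * ζ ^ n) atTop (𝓝 0)) :
    (leadCoeff hζ s : ℝ) = α :=
  hζ.tendsto_unique (leadCoeff_spec hζ s) h

theorem eventually_eq_zero_of_tendsto_intCast {s : ℕ → ℤ}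
    (h : Tendsto (fun n => (s n : ℝ)) atTop (𝓝 0)) : ∀ᶠ n in atTop, s n = 0 := by
  filter_upwards [(Metric.tendsto_nhds.1 h) 1 one_pos] with n hn
  rw [Real.dist_eq, sub_zero] at hn
  exact Int.abs_lt_one_iff.1 (by exact_mod_cast hn)

theorem IsPisot.coeff_zero_ne_zero {ζ : ℝ} (hζ : IsPisot ζ) : (minpoly ℤ ζ).coeff 0 ≠ 0 := by
  have h := minpoly.coeff_zero_ne_zero (hζ.1.tower_top (A := ℚ)) hζ.pos.ne'
  rw [← hζ.map_minpoly_int, coeff_map] at h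
  exact fun h0 => h (by rw [h0, map_zero])

/-- Leading coefficient `0` means integers tending to `0`, hence eventually zero; the constant
coefficient being nonzero, the recurrence propagates the zeros backwards. -/
theorem leadCoeff_injective {ζ : ℝ} (hζ : IsPisot ζ) : Function.Injective (leadCoeff hζ) := by
  rw [injective_iff_map_eq_zero]
  intro s hs
  have h := leadCoeff_spec hζ s
  simp only [hs, ZeroMemClass.coe_zero, zero_mul, sub_zero] at h
  obtain ⟨N, hN⟩ := eventually_atTop.1 (eventually_eq_zero_of_tendsto_intCast h)
  have hback : ∀ M, (∀ n ≥ M, (s : ℕ → ℤ) n = 0) → ∀ n, (s : ℕ → ℤ) n = 0 := by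
    intro M
    induction M with
    | zero => exact fun h n => h n (Nat.zero_le n)
    | succ M ih =>
      refine fun hM => ih fun n hn => ?_
      rcases Nat.eq_or_lt_of_le hn with rfl | hn
      · have hrec := congrFun (mem_recSeq.1 s.2) M
        rw [aeval_seqShift_apply, Finset.sum_range_succ', Finset.sum_eq_zero, zero_add, add_zero,
          Pi.zero_apply] at hrec
        · exact (mul_eq_zero.1 hrec).resolve_left hζ.coeff_zero_ne_zero
        · exact fun i _ => by rw [hM _ (by omega), mul_zero]
      · exact hM n hn
  exact Subtype.ext (funext (hback N hN))

theorem self_mul_leadCoeff {ζ : ℝ} (hζ : IsPisot ζ) (s : recSeq ζ) :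
    (leadCoeff hζ ⟨seqShift ℤ s, seqShift_mem_recSeq s.2⟩ : ℝ) = ζ * leadCoeff hζ s := by
  refine leadCoeff_eq_of_tendsto hζ ?_
  refine ((tendsto_add_atTop_iff_nat 1).2 (leadCoeff_spec hζ s)).congr fun n => ?_
  simp only [seqShift_apply, pow_succ]
  ring

/-- The leading coefficients form a `ℤ[ζ]`-module; for a unit this allows division by powers of `ζ`.
-/
theorem adjoin_mul_leadCoeff {ζ c : ℝ} (hζ : IsPisot ζ) (hc : c ∈ Algebra.adjoin ℤ {ζ}) :
    ∀ s, ∃ t, (leadCoeff hζ t : ℝ) = c * leadCoeff hζ s := by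
  induction hc using Algebra.adjoin_induction with
  | mem x hx =>
    intro s
    rw [Set.mem_singleton_iff.1 hx]
    exact ⟨_, self_mul_leadCoeff hζ s⟩
  | algebraMap m => exact fun s => ⟨m • s, by simp⟩
  | add x y _ _ hx hy =>
    intro s
    obtain ⟨t, ht⟩ := hx s
    obtain ⟨u, hu⟩ := hy s
    exact ⟨t + u, by rw [map_add, Submodule.coe_add, ht, hu, add_mul]⟩
  | mul x y _ _ hx hy =>
    intro s
    obtain ⟨t, ht⟩ := hy s
    obtain ⟨u, hu⟩ := hx t
    exact ⟨u, by rw [hu, ht, mul_assoc]⟩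

/-- The nearest integers to `α ζ ^ n` eventually satisfy the recurrence, so that `α ζ ^ n` is a
leading coefficient for large `n`. -/
theorem exists_leadCoeff_eq_mul_pow {ζ α : ℝ} (hζ : IsPisot ζ) (hα : α ∈ pisotSet ζ) :
    ∃ N, ∀ n ≥ N, ∃ s, (leadCoeff hζ s : ℝ) = ζ ^ n * α := by
  set u : ℕ → ℤ := fun n => round (α * ζ ^ n) with hu
  have herr : Tendsto (fun n => (u n : ℝ) - α * ζ ^ n) atTop (𝓝 0) := by
    rw [tendsto_zero_iff_abs_tendsto_zero]
    exact hα.congr fun n => abs_sub_comm _ _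
  have hroot : (minpoly ℤ ζ).sum (fun i a => (a : ℝ) * ζ ^ i) = 0 := by
    simpa [aeval_eq_sum_range, sum_over_range] using minpoly.aeval ℤ ζ
  -- The recurrence annihilates `α ζ^n`, so only a fixed combination of rounding errors remains.
  have hrec : Tendsto (fun n => ((aeval (seqShift ℤ) (minpoly ℤ ζ) u n : ℤ) : ℝ)) atTop (𝓝 0) := by
    have h : Tendsto (fun n => ∑ i ∈ Finset.range ((minpoly ℤ ζ).natDegree + 1),
        ((minpoly ℤ ζ).coeff i : ℝ) * ((u (n + i) : ℝ) - α * ζ ^ (n + i))) atTop (𝓝 0) := by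
      have := tendsto_finsetSum (Finset.range ((minpoly ℤ ζ).natDegree + 1)) fun i _ =>
        ((tendsto_add_atTop_iff_nat i).2 herr).const_mul ((minpoly ℤ ζ).coeff i : ℝ)
      simpa using this
    refine h.congr fun n => ?_
    rw [aeval_seqShift_apply]
    push_cast
    rw [sum_over_range _ (by simp)] at hroot
    simp only [mul_sub, Finset.sum_sub_distrib, sub_eq_self]
    calc _ = α * ζ ^ n * ∑ i ∈ Finset.range ((minpoly ℤ ζ).natDegree + 1),
          ((minpoly ℤ ζ).coeff i : ℝ) * ζ ^ i := by
          rw [Finset.mul_sum]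
          exact Finset.sum_congr rfl fun i _ => by ring
      _ = 0 := by rw [hroot, mul_zero]
  obtain ⟨N, hN⟩ := eventually_atTop.1 (eventually_eq_zero_of_tendsto_intCast hrec)
  refine ⟨N, fun m hm => ⟨⟨fun n => u (n + m), mem_recSeq.2 ?_⟩, leadCoeff_eq_of_tendsto hζ ?_⟩⟩
  · funext n
    rw [Pi.zero_apply, ← hN (n + m) (by omega), aeval_seqShift_apply, aeval_seqShift_apply]
    exact Finset.sum_congr rfl fun i _ => by rw [add_right_comm]
  · refine ((tendsto_add_atTop_iff_nat m).2 herr).congr fun n => ?_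
    rw [pow_add]
    ring

/-! ### Units and divisibility by `ζ` -/

/-- The inverse of `x` lies in `ℤ[x]` as soon as it is integral. -/
theorem inv_mem_adjoin_of_isIntegral_inv {x : ℝ} (hx : x ≠ 0) (h : IsIntegral ℤ x⁻¹) :
    x⁻¹ ∈ Algebra.adjoin ℤ {x} := by
  obtain ⟨d, hd⟩ := Nat.exists_eq_succ_of_ne_zero (minpoly.natDegree_pos h).ne'
  have hroot := minpoly.aeval ℤ x⁻¹
  rw [aeval_eq_sum_range, Finset.sum_range_succ, (minpoly.monic h).coeff_natDegree, one_smul, hd,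
    add_comm, add_eq_zero_iff_eq_neg] at hroot
  -- The integral equation of `x⁻¹`, of degree `d + 1`, is multiplied by `x ^ d`.
  have hxd : x⁻¹ = x ^ d * x⁻¹ ^ (d + 1) := by
    rw [pow_succ, ← mul_assoc, ← mul_pow, mul_inv_cancel₀ hx, one_pow, one_mul]
  have hself : x ∈ Algebra.adjoin ℤ {x} := Algebra.self_mem_adjoin_singleton ℤ x
  rw [hxd, hroot, mul_neg, Finset.mul_sum]
  refine neg_mem (sum_mem fun i hi => ?_)
  have hi' : i ≤ d := Nat.lt_succ_iff.1 (Finset.mem_range.1 hi)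
  rw [mul_smul_comm, show x ^ d * x⁻¹ ^ i = x ^ (d - i) by
    rw [inv_pow, pow_sub₀ _ hx hi']]
  exact Subalgebra.smul_mem _ (pow_mem hself _) _

/-- `ζ` as an element of `ℤ[ζ]`. -/
def adjoinGen (ζ : ℝ) : Algebra.adjoin ℤ {ζ} := ⟨ζ, Algebra.self_mem_adjoin_singleton ℤ ζ⟩

theorem IsPisotUnit.inv_mem_adjoin {ζ : ℝ} (h : IsPisotUnit ζ) :
    ζ⁻¹ ∈ Algebra.adjoin ℤ {ζ} := by
  obtain ⟨hζ, u, hu⟩ := h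
  refine inv_mem_adjoin_of_isIntegral_inv hζ.pos.ne' ?_
  have : ((u⁻¹ : (integralClosure ℤ ℝ)ˣ) : integralClosure ℤ ℝ).1 = ζ⁻¹ := by
    refine eq_inv_of_mul_eq_one_left ?_
    rw [← hu]
    exact congrArg Subtype.val u.inv_mul
  rw [← this]
  exact ((u⁻¹ : (integralClosure ℤ ℝ)ˣ) : integralClosure ℤ ℝ).2

theorem IsPisot.isPisotUnit_of_isUnit {ζ : ℝ} (hζ : IsPisot ζ) (h : IsUnit (adjoinGen ζ)) :
    IsPisotUnit ζ := by
  have hle : Algebra.adjoin ℤ {ζ} ≤ integralClosure ℤ ℝ :=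
    Algebra.adjoin_le (Set.singleton_subset_iff.2 hζ.1)
  obtain ⟨u, hu⟩ := h.map (Subalgebra.inclusion hle)
  exact ⟨hζ, u, by rw [hu]; rfl⟩

theorem mem_pisotSet_of_self_mul_mem {ζ a : ℝ} (h : ζ * a ∈ pisotSet ζ) : a ∈ pisotSet ζ := by
  refine (tendsto_add_atTop_iff_nat 1).1 (h.congr fun n => ?_)
  rw [pow_succ]
  ring_nf

set_option synthInstance.maxHeartbeats 200000 in
/-- The module `pisotAdjoinModule ζ` is divisible by `ζ`. -/
theorem exists_adjoinGen_smul_eq {ζ : ℝ} (hζ : IsPisot ζ) (x : pisotAdjoinModule ζ) :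
    ∃ y : pisotAdjoinModule ζ, adjoinGen ζ • y = x := by
  have h : ζ * (ζ⁻¹ * x) = x := mul_inv_cancel_left₀ hζ.pos.ne' _
  exact ⟨⟨ζ⁻¹ * x, mem_pisotSet_of_self_mul_mem (by rw [h]; exact x.2)⟩, Subtype.ext h⟩

theorem IsPisot.natDegree_pos {ζ : ℝ} (hζ : IsPisot ζ) : 0 < (minpoly ℚ ζ).natDegree :=
  minpoly.natDegree_pos hζ.1.tower_top

/-- The tautological identification of the two modules carried by `pisotSet ζ`. -/
def pisotModuleEquiv (ζ : ℝ) : pisotIntModule ζ ≃ₗ[ℤ] pisotAdjoinModule ζ :=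
  AddEquiv.toIntLinearEquiv
    { toFun := fun x => ⟨x.1, x.2⟩
      invFun := fun x => ⟨x.1, x.2⟩
      map_add' := fun _ _ => rfl }

theorem IsPisot.nontrivial_pisotIntModule {ζ : ℝ} (hζ : IsPisot ζ) :
    Nontrivial (pisotIntModule ζ) := by
  have : Nonempty (Fin (minpoly ℚ ζ).natDegree) := ⟨⟨0, hζ.natDegree_pos⟩⟩
  exact ((leadCoeff_injective hζ).comp (recSeqEquiv hζ).symm.injective).nontrivial

theorem IsPisot.nontrivial_pisotAdjoinModule {ζ : ℝ} (hζ : IsPisot ζ) :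
    Nontrivial (pisotAdjoinModule ζ) :=
  have := hζ.nontrivial_pisotIntModule
  (pisotModuleEquiv ζ).symm.toEquiv.nontrivial

/-! ### Finite or free modules force a unit -/

/-- By Nakayama some `r ≡ 1` modulo `ζ` kills the module; torsion-freeness gives `r = 0`, so `ζ`
divides `1`. -/
theorem IsPisot.isPisotUnit_of_finite_adjoin {ζ : ℝ} (hζ : IsPisot ζ)
    (h : Module.Finite (Algebra.adjoin ℤ {ζ}) (pisotAdjoinModule ζ)) : IsPisotUnit ζ := by
  refine hζ.isPisotUnit_of_isUnit ?_
  obtain ⟨r, hr, hr0⟩ := Submodule.exists_sub_one_mem_and_smul_eq_zero_of_fg_of_le_smul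
    (Ideal.span {adjoinGen ζ}) (⊤ : Submodule (Algebra.adjoin ℤ {ζ}) (pisotAdjoinModule ζ)) h.1
    fun x _ => by
      obtain ⟨y, rfl⟩ := exists_adjoinGen_smul_eq hζ x
      exact Submodule.smul_mem_smul (Ideal.mem_span_singleton_self _) trivial
  have := hζ.nontrivial_pisotAdjoinModule
  obtain ⟨x, hx⟩ := exists_ne (0 : pisotAdjoinModule ζ)
  have hr' : r = 0 := (smul_eq_zero.1 (hr0 x trivial)).resolve_right hx
  rw [hr', zero_sub, neg_mem_iff, Ideal.mem_span_singleton] at hr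
  exact isUnit_of_dvd_one hr

set_option synthInstance.maxHeartbeats 200000 in
theorem IsPisot.isPisotUnit_of_finite_int {ζ : ℝ} (hζ : IsPisot ζ)
    (h : Module.Finite ℤ (pisotIntModule ζ)) : IsPisotUnit ζ := by
  have := Module.Finite.equiv (pisotModuleEquiv ζ)
  exact hζ.isPisotUnit_of_finite_adjoin
    (Module.Finite.of_restrictScalars_finite ℤ (Algebra.adjoin ℤ {ζ}) _)

/-- Writing a basis vector as `ζ y`, its own coordinate reads `1 = ζ` times a coordinate of `y`. -/
theorem IsPisot.isPisotUnit_of_free_adjoin {ζ : ℝ} (hζ : IsPisot ζ)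
    (h : Module.Free (Algebra.adjoin ℤ {ζ}) (pisotAdjoinModule ζ)) : IsPisotUnit ζ := by
  refine hζ.isPisotUnit_of_isUnit ?_
  have := hζ.nontrivial_pisotAdjoinModule
  let b := Module.Free.chooseBasis (Algebra.adjoin ℤ {ζ}) (pisotAdjoinModule ζ)
  obtain ⟨i⟩ := b.index_nonempty
  obtain ⟨y, hy⟩ := exists_adjoinGen_smul_eq hζ (b i)
  refine IsUnit.of_mul_eq_one (b.repr y i) ?_
  have := congrArg (fun x => b.repr x i) hy
  simpa using this

theorem IsPisot.rank_pisotIntModule_le {ζ : ℝ} (hζ : IsPisot ζ) :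
    Module.rank ℤ (pisotIntModule ζ) ≤ (minpoly ℚ ζ).natDegree := by
  refine rank_le fun F hF => ?_
  choose N hN using fun x : F => exists_leadCoeff_eq_mul_pow hζ x.1.2
  -- One exponent serves the whole finite family, so a single power of `ζ` carries it into the
  -- leading coefficients and independence is preserved.
  choose v hv using fun x : F => hN x (Finset.univ.sup N) (Finset.le_sup (Finset.mem_univ x))
  have hli : LinearIndependent ℤ v := by
    rw [Fintype.linearIndependent_iff] at hF ⊢
    refine fun g hg => hF g (Subtype.ext ?_)
    have h := congrArg (fun s => (leadCoeff hζ s : ℝ)) hg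
    simp only [map_sum, map_smul, Submodule.coe_sum, Submodule.coe_smul, hv, map_zero,
      ZeroMemClass.coe_zero, ← mul_smul_comm, ← Finset.mul_sum] at h
    simpa using (mul_eq_zero.1 h).resolve_left (pow_ne_zero _ hζ.pos.ne')
  have := Module.Finite.equiv (recSeqEquiv hζ).symm
  have hcard := hli.fintype_card_le_finrank
  rwa [(recSeqEquiv hζ).finrank_eq, Module.finrank_fin_fun, Fintype.card_coe] at hcard

theorem IsPisot.isPisotUnit_of_free_int {ζ : ℝ} (hζ : IsPisot ζ)
    (h : Module.Free ℤ (pisotIntModule ζ)) : IsPisotUnit ζ :=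
  hζ.isPisotUnit_of_finite_int <| Module.rank_lt_aleph0_iff.1 <|
    hζ.rank_pisotIntModule_le.trans_lt (Cardinal.natCast_lt_aleph0)

/-! ### Structure for Pisot units -/

theorem IsPisotUnit.leadCoeff_surjective {ζ : ℝ} (h : IsPisotUnit ζ) :
    Function.Surjective (leadCoeff h.1) := by
  intro x
  obtain ⟨N, hN⟩ := exists_leadCoeff_eq_mul_pow h.1 x.2
  obtain ⟨s, hs⟩ := hN N le_rfl
  obtain ⟨t, ht⟩ := adjoin_mul_leadCoeff h.1 (pow_mem h.inv_mem_adjoin N) s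
  have hpow : ζ ^ N ≠ 0 := pow_ne_zero N h.1.pos.ne'
  exact ⟨t, Subtype.ext (by rw [ht, hs, inv_pow, inv_mul_cancel_left₀ hpow])⟩

/-- For a Pisot unit, `pisotIntModule ζ` is free of rank the degree of `ζ`. -/
noncomputable def IsPisotUnit.pisotIntModuleEquiv {ζ : ℝ} (h : IsPisotUnit ζ) :
    pisotIntModule ζ ≃ₗ[ℤ] (Fin (minpoly ℚ ζ).natDegree → ℤ) :=
  (LinearEquiv.ofBijective (leadCoeff h.1)
    ⟨leadCoeff_injective h.1, h.leadCoeff_surjective⟩).symm.trans (recSeqEquiv h.1)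

theorem IsPisotUnit.finite_int {ζ : ℝ} (h : IsPisotUnit ζ) :
    Module.Finite ℤ (pisotIntModule ζ) :=
  Module.Finite.equiv h.pisotIntModuleEquiv.symm

set_option synthInstance.maxHeartbeats 200000 in
theorem IsPisotUnit.finite_adjoin {ζ : ℝ} (h : IsPisotUnit ζ) :
    Module.Finite (Algebra.adjoin ℤ {ζ}) (pisotAdjoinModule ζ) := by
  have := h.finite_int
  have := Module.Finite.equiv (pisotModuleEquiv ζ)
  exact Module.Finite.of_restrictScalars_finite ℤ (Algebra.adjoin ℤ {ζ}) _

theorem IsPisot.finrank_adjoin {ζ : ℝ} (hζ : IsPisot ζ) :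
    Module.finrank ℤ (Algebra.adjoin ℤ {ζ}) = (minpoly ℚ ζ).natDegree := by
  rw [(Algebra.adjoin.powerBasis' hζ.1).finrank, Algebra.adjoin.powerBasis'_dim,
    ← hζ.map_minpoly_int, natDegree_map_eq_of_injective (algebraMap ℤ ℚ).injective_int]

theorem IsPisotUnit.free_adjoin {ζ : ℝ} (h : IsPisotUnit ζ)
    [IsPrincipalIdealRing (Algebra.adjoin ℤ {ζ})] :
    Module.Free (Algebra.adjoin ℤ {ζ}) (pisotAdjoinModule ζ) :=
  have := h.finite_adjoin
  inferInstance

/-- The module and `ℤ[ζ]` have the same `ℤ`-rank, so multiplicativity of ranks leaves `1`. -/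
theorem IsPisotUnit.finrank_pisotAdjoinModule {ζ : ℝ} (h : IsPisotUnit ζ)
    [IsPrincipalIdealRing (Algebra.adjoin ℤ {ζ})] :
    Module.finrank (Algebra.adjoin ℤ {ζ}) (pisotAdjoinModule ζ) = 1 := by
  have := h.free_adjoin
  have := Module.Free.of_basis (Algebra.adjoin.powerBasis' h.1.1).basis
  have hmul := Module.finrank_mul_finrank ℤ (Algebra.adjoin ℤ {ζ}) (pisotAdjoinModule ζ)
  rw [← (pisotModuleEquiv ζ).finrank_eq, h.pisotIntModuleEquiv.finrank_eq, Module.finrank_fin_fun,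
    h.1.finrank_adjoin] at hmul
  exact Nat.eq_of_mul_eq_mul_left h.1.natDegree_pos (by rw [hmul, mul_one])

theorem mainTheorem1 (ζ : ℝ) (hζ : IsPisot ζ) :
    (Module.Finite ℤ (pisotIntModule ζ) ↔ IsPisotUnit ζ) ∧
    (Module.Finite (Algebra.adjoin ℤ {ζ}) (pisotAdjoinModule ζ) ↔ IsPisotUnit ζ) ∧
    (Module.Free ℤ (pisotIntModule ζ) → IsPisotUnit ζ) ∧
    (Module.Free (Algebra.adjoin ℤ {ζ}) (pisotAdjoinModule ζ) → IsPisotUnit ζ) ∧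
    (IsPisotUnit ζ →
      Module.Free ℤ (pisotIntModule ζ) ∧
      Nonempty (pisotIntModule ζ ≃ₗ[ℤ] (Fin (minpoly ℚ ζ).natDegree → ℤ)) ∧
      (IsPrincipalIdealRing (Algebra.adjoin ℤ {ζ}) →
        Module.Free (Algebra.adjoin ℤ {ζ}) (pisotAdjoinModule ζ) ∧
        Module.rank (Algebra.adjoin ℤ {ζ}) (pisotAdjoinModule ζ) = 1 ∧
        Nonempty (pisotAdjoinModule ζ ≃ₗ[Algebra.adjoin ℤ {ζ}] Algebra.adjoin ℤ {ζ}))) := by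
  refine ⟨⟨hζ.isPisotUnit_of_finite_int, fun h => h.finite_int⟩,
    ⟨hζ.isPisotUnit_of_finite_adjoin, fun h => h.finite_adjoin⟩,
    hζ.isPisotUnit_of_free_int, hζ.isPisotUnit_of_free_adjoin, fun h =>
      ⟨Module.Free.of_equiv h.pisotIntModuleEquiv.symm, ⟨h.pisotIntModuleEquiv⟩, fun _ => ?_⟩⟩
  have := h.finite_adjoin
  have := h.free_adjoin
  have hrank := h.finrank_pisotAdjoinModule
  refine ⟨this, ?_, ⟨LinearEquiv.ofFinrankEq _ _ ?_⟩⟩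
  · rw [← Module.finrank_eq_rank, hrank, Nat.cast_one]
  · rw [hrank, Module.finrank_self]
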